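/- Let $k$ be a field; all algebras (associative, unital), coalgebras and bialgebras are over $k$. For bialgebras $N,T$ and an algebra $A$, a linear map $\psi\colon N\otimes T\to A$ is a bimeasuring if, in Sweedler notation, for all $n,m\in N$ and $t,s\in T$, $$\psi(nm,t)=\psi(n,t_1)\psi(m,t_2),\quad \psi(1_N,t)=\varepsilon(t)1_A,\quad \psi(n,ts)=\psi(n_1,t)\psi(n_2,s),\quad \psi(n,1_T)=\varepsilon(n)1_A.$$ A bimeasuring $\theta\colon B\otimes T\to A$, with $B$ a bialgebra, is universal, and $B=B(T,A)$ is then called the universal bimeasuring bialgebra, if for every bialgebra $N$ and every bimeasuring $f\colon N\otimes T\to A$ there is a unique bialgebra map $\overline f\colon N\to B$ with $f=\theta\circ(\overline f\otimes 1_T)$. Let $A$ be a commutative algebra and $T$ a cocommutative bialgebra. Then the universal bimeasuring bialgebra $B(T,A)$ exists and is commutative: a universal bimeasuring $B\otimes T\to A$ exists, and for every universal bimeasuring $\theta\colon B\otimes T\to A$ the algebra $B$ is commutative. -/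

import Mathlib

open scoped TensorProduct

universe u v w y

/-- `ψ : C ⊗ B → A` is a measuring of the algebra `B` to the algebra `A` by the coalgebra `C`:
`ψ(c, b b') = ψ(c₁, b) ψ(c₂, b')` and `ψ(c, 1) = ε(c) 1`. -/
structure IsMeasuring {k C B A : Type*} [Field k] [AddCommGroup C] [Module k C] [Coalgebra k C]
    [Ring B] [Algebra k B] [Ring A] [Algebra k A] (ψ : C ⊗[k] B →ₗ[k] A) : Prop where
  map_mul : ∀ (c : C) (b b' : B), ψ (c ⊗ₜ[k] (b * b')) =
    LinearMap.mul' k A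
      (TensorProduct.map ((TensorProduct.curry ψ).flip b) ((TensorProduct.curry ψ).flip b')
        (Coalgebra.comul (R := k) c))
  map_one : ∀ c : C, ψ (c ⊗ₜ[k] (1 : B)) = algebraMap k A (Coalgebra.counit (R := k) c)

/-- `ψ : N ⊗ T → A` is a bimeasuring: `N` measures `T` to `A` and `T` measures `N` to `A`. -/
structure IsBimeasuring {k N T A : Type*} [Field k] [Ring N] [Bialgebra k N]
    [Ring T] [Bialgebra k T] [Ring A] [Algebra k A] (ψ : N ⊗[k] T →ₗ[k] A) : Prop where
  left : IsMeasuring ψ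
  right : IsMeasuring (ψ ∘ₗ (TensorProduct.comm k T N).toLinearMap)

/-- `θ : B ⊗ T → A` is the (left) universal bimeasuring, i.e. `B`, together with `θ`, is the
universal bimeasuring bialgebra `B(T, A)`: `θ` is a bimeasuring, and every bimeasuring
`f : N ⊗ T → A` is `θ ∘ (g ⊗ 1)` for a unique bialgebra map `g : N → B`. -/
structure IsUniversalBimeasuring {k : Type u} {T : Type v} {A : Type w} {B : Type y}
    [Field k] [Ring T] [Bialgebra k T] [Ring A] [Algebra k A] [Ring B] [Bialgebra k B]
    (θ : B ⊗[k] T →ₗ[k] A) : Prop where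
  isBimeasuring : IsBimeasuring θ
  existsUnique_hom : ∀ (N : Type y) [Ring N] [Bialgebra k N] (f : N ⊗[k] T →ₗ[k] A),
    IsBimeasuring f → ∃! g : N →ₐc[k] B, f = θ ∘ₗ LinearMap.rTensor T (g : N →ₗ[k] B)

/-!
Write `Hom(T, A)` for the convolution algebra of linear maps `T → A`; it is commutative because `T` is
cocommutative and `A` is commutative. A bimeasuring `N ⊗ T → A` is the same as an algebra homomorphism
`Θ : N → Hom(T, A)` that also satisfies `Θ n (t s) = Θ n₁ t * Θ n₂ s` and `Θ n 1 = ε n`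
(`IsBimeasuring.algHom`, `AlgHom.IsMeasuringHom`). Since `A` is commutative, these two conditions are
equations between algebra homomorphisms out of `N`, so they can be checked on generators of `N`.

To `Θ` belong the algebra homomorphisms `P₀ = (ε, Θ) : N → k × Hom(T, A)` and
`Pₙ₊₁ = (Pₙ ⊗ Pₙ) ∘ Δ : N → Vₙ ⊗ Vₙ = Vₙ₊₁`, which together form `P : N → ∏ₙ Vₙ`
(`AlgHom.toConvTowerPi`). The map `P` is natural in bialgebra maps compatible with the bimeasurings,
and its target is commutative and depends only on `k`, `T` and `A`. The kernels of the `Pₙ` decrease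
and `k` is a field, so an element killed by all `Pₙ ⊗ Pₙ` is killed by `P ⊗ P`; hence `ker P` is a
biideal, and the bimeasuring descends to `N / ker P` (`AlgHom.IsMeasuringHom.exists_quotient`).

Existence: let `W` be the free product of all bialgebras (in the given universe) equipped with a
bimeasuring, and let `B` be the image of `P` on `W`. It lies in `∏ₙ Vₙ`, which bounds its size. Every
bimeasuring factors through `W`, hence through `B`, and the factorization is unique because `P` is
natural and is injective on `B`.

Commutativity: for a universal `θ : B ⊗ T → A`, the bimeasuring on `B / ker P` induces a map
`B / ker P → B`, and by uniqueness the composite `B → B / ker P → B` is the identity. So `P` embeds `B`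
into the commutative algebra `∏ₙ Vₙ` (`IsUniversalBimeasuring.toConvTowerPi_injective`).
-/

/-! ### Descending structure along a surjection -/

/-- An algebra homomorphism that identifies all pairs identified by the surjection `π` descends
along `π`. -/
noncomputable def AlgHom.descend {R W Q C : Type*} [CommSemiring R] [Semiring W] [Semiring Q]
    [Semiring C] [Algebra R W] [Algebra R Q] [Algebra R C] (π : W →ₐ[R] Q)
    (hπ : Function.Surjective π) (g : W →ₐ[R] C) (h : ∀ a b, π a = π b → g a = g b) :
    Q →ₐ[R] C :=
  have key : ∀ a, g (Function.surjInv hπ (π a)) = g a := fun a =>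
    h _ _ (Function.surjInv_eq hπ (π a))
  AlgHom.ofLinearMap
    { toFun := fun q => g (Function.surjInv hπ q)
      map_add' := hπ.forall₂.2 fun a b => by rw [← map_add, key, key, key, map_add]
      map_smul' := fun r => hπ.forall.2 fun a => by
        rw [← map_smul, key, key, map_smul, RingHom.id_apply] }
    (show g (Function.surjInv hπ 1) = 1 by rw [← map_one π, key, map_one])
    (hπ.forall₂.2 fun a b => show g (Function.surjInv hπ _) =
        g (Function.surjInv hπ _) * g (Function.surjInv hπ _) by
      rw [← map_mul, key, key, key, map_mul])

theorem AlgHom.descend_comp {R W Q C : Type*} [CommSemiring R] [Semiring W] [Semiring Q]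
    [Semiring C] [Algebra R W] [Algebra R Q] [Algebra R C] (π : W →ₐ[R] Q)
    (hπ : Function.Surjective π) (g : W →ₐ[R] C) (h : ∀ a b, π a = π b → g a = g b) :
    (AlgHom.descend π hπ g h).comp π = g :=
  AlgHom.ext fun a => h _ _ (Function.surjInv_eq hπ (π a))

open Coalgebra in
/-- A bialgebra structure on the target of a surjective algebra homomorphism along which the
comultiplication and the counit descend. -/
noncomputable abbrev Bialgebra.ofSurjective {R W Q : Type*} [CommRing R] [Semiring W]
    [Bialgebra R W] [Ring Q] [Algebra R Q] (π : W →ₐ[R] Q) (hπ : Function.Surjective π)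
    (Δ : Q →ₐ[R] Q ⊗[R] Q) (ε : Q →ₐ[R] R)
    (hΔ : Δ.comp π = (Algebra.TensorProduct.map π π).comp (Bialgebra.comulAlgHom R W))
    (hε : ε.comp π = Bialgebra.counitAlgHom R W) : Bialgebra R Q := by
  have hΔ' : Δ.toLinearMap ∘ₗ π.toLinearMap =
      _root_.TensorProduct.map π.toLinearMap π.toLinearMap ∘ₗ comul := congr(($hΔ).toLinearMap)
  have hε' : ε.toLinearMap ∘ₗ π.toLinearMap = counit := congr(($hε).toLinearMap)
  refine .ofAlgHom Δ ε ?_ ?_ ?_ <;>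
    refine (AlgHom.cancel_right hπ).1 (AlgHom.toLinearMap_injective ?_) <;>
    simp only [coassoc_simps, AlgHom.comp_toLinearMap, Algebra.TensorProduct.toLinearMap_map,
      hΔ', hε']
  · simp [coassoc_simps]
  · rw [CoassocSimps.map_counit_comp_comul_left]; rfl
  · rw [CoassocSimps.map_counit_comp_comul_right]; rfl

/-- If the kernels of `p n` decrease to zero, then the maps `p n ⊗ p n` jointly separate points. A
tensor is supported on a finite-dimensional subspace, on which some `p n` is already injective. -/
theorem TensorProduct.eq_zero_of_map_eq_zero {k Q : Type*} [Field k] [AddCommGroup Q] [Module k Q]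
    {V : ℕ → Type*} [∀ n, AddCommGroup (V n)] [∀ n, Module k (V n)] (p : ∀ n, Q →ₗ[k] V n)
    (anti : Antitone fun n => LinearMap.ker (p n)) (sep : ∀ q, (∀ n, p n q = 0) → q = 0)
    (z : Q ⊗[k] Q) (hz : ∀ n, TensorProduct.map (p n) (p n) z = 0) : z = 0 := by
  obtain ⟨M, N, _, _, h⟩ := TensorProduct.exists_finite_submodule_of_setFinite {z} (by simp)
  have hM : M ≤ M ⊔ N := le_sup_left
  have hN : N ≤ M ⊔ N := le_sup_right
  obtain ⟨z', rfl⟩ := h rfl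
  let F : Submodule k Q := M ⊔ N
  let r : ∀ n, F →ₗ[k] V n := fun n => p n ∘ₗ F.subtype
  obtain ⟨n, hn⟩ := IsArtinian.monotone_stabilizes (R := k) (M := F)
    ⟨fun n => OrderDual.toDual (LinearMap.ker (r n)), fun i j hij x hx => anti hij hx⟩
  have hinj : Function.Injective (r n) := by
    rw [← LinearMap.ker_eq_bot, eq_bot_iff]
    intro x hx
    refine Subtype.ext (sep x fun m => ?_)
    rcases le_total m n with hmn | hmn
    · exact anti hmn hx
    · have h : LinearMap.ker (r n) = LinearMap.ker (r m) := hn m hmn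
      exact h.le hx
  have h2 : TensorProduct.map (r n) (r n) (TensorProduct.map (Submodule.inclusion hM)
      (Submodule.inclusion hN) z') = 0 := by
    rw [← hz n, TensorProduct.mapIncl, ← LinearMap.comp_apply, ← TensorProduct.map_comp,
      ← LinearMap.comp_apply, ← TensorProduct.map_comp]
    rfl
  have h3 := (map_eq_zero_iff _ (TensorProduct.map_injective_of_flat_flat _ _ hinj hinj)).1 h2
  have h4 := congrArg (TensorProduct.map F.subtype F.subtype) h3
  rw [← LinearMap.comp_apply, ← TensorProduct.map_comp, map_zero] at h4
  exact h4

/-! ### Bimeasurings as algebra homomorphisms into convolution algebras -/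

section Convolution

variable {k T A : Type*} [Field k] [Ring T] [Bialgebra k T] [CommRing A] [Algebra k A]

open WithConv

variable (k T A) in
/-- Evaluation at `1`, on the convolution algebra of linear maps `T → A`. -/
noncomputable def convEvalOne : WithConv (T →ₗ[k] A) →ₐ[k] A :=
  AlgHom.ofLinearMap
    (LinearMap.applyₗ (1 : T) ∘ₗ (WithConv.linearEquiv k (T →ₗ[k] A)).toLinearMap)
    (by simp)
    (fun f g => by simp [Algebra.TensorProduct.one_def])

variable (k T A) in
/-- Precomposition with the multiplication `T ⊗ T → T`, which is a homomorphism of convolution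
algebras because the multiplication is a coalgebra homomorphism. -/
noncomputable def convCompMul :
    WithConv (T →ₗ[k] A) →ₐ[k] WithConv (T ⊗[k] T →ₗ[k] A) :=
  AlgHom.ofLinearMap
    ((WithConv.linearEquiv k (T ⊗[k] T →ₗ[k] A)).symm.toLinearMap ∘ₗ
      LinearMap.lcomp k A (LinearMap.mul' k T) ∘ₗ
        (WithConv.linearEquiv k (T →ₗ[k] A)).toLinearMap)
    (by
      ext t s
      simp [LinearMap.convOne_def, mul_comm])
    (fun f g => WithConv.ofConv_injective
      (LinearMap.convMul_comp_coalgHom_distrib f g (Bialgebra.mulCoalgHom k T)))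

variable (k T A) in
/-- The external product `f ⊗ g ↦ (t ⊗ s ↦ f t * g s)` of linear maps into the commutative algebra
`A`, as a homomorphism of convolution algebras. -/
noncomputable def convExternalMul :
    WithConv (T →ₗ[k] A) ⊗[k] WithConv (T →ₗ[k] A) →ₐ[k] WithConv (T ⊗[k] T →ₗ[k] A) :=
  Algebra.TensorProduct.algHomOfLinearMapTensorProduct
    ((WithConv.linearEquiv k (T ⊗[k] T →ₗ[k] A)).symm.toLinearMap ∘ₗ
      LinearMap.llcomp k _ _ _ (LinearMap.mul' k A) ∘ₗ
      TensorProduct.homTensorHomMap (.id k) T T A A ∘ₗ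
      TensorProduct.map (WithConv.linearEquiv k (T →ₗ[k] A)).toLinearMap
        (WithConv.linearEquiv k (T →ₗ[k] A)).toLinearMap)
    (fun f f' g g' => by
      have h := LinearMap.algHom_comp_convMul_distrib (Algebra.TensorProduct.lmul' k (S := A))
        (toConv (TensorProduct.map f.ofConv g.ofConv))
        (toConv (TensorProduct.map f'.ofConv g'.ofConv))
      rw [TensorProduct.map_convMul_map] at h
      exact WithConv.ofConv_injective h)
    (by
      ext t s
      simp [LinearMap.convOne_def, mul_comm])

@[simp]
theorem convExternalMul_tmul (f g : WithConv (T →ₗ[k] A)) (t s : T) :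
    (convExternalMul k T A (f ⊗ₜ g)).ofConv (t ⊗ₜ s) = f.ofConv t * g.ofConv s := rfl

/-- For an algebra homomorphism `Θ : N → Hom(T, A)` into the convolution algebra, the condition that
the linear map `n ⊗ t ↦ Θ n t` measures `T` to `A`, as two equations between algebra
homomorphisms. -/
structure AlgHom.IsMeasuringHom {N : Type*} [Semiring N] [Bialgebra k N]
    (Θ : N →ₐ[k] WithConv (T →ₗ[k] A)) : Prop where
  mul : (convCompMul k T A).comp Θ =
    (convExternalMul k T A).comp ((Algebra.TensorProduct.map Θ Θ).comp (Bialgebra.comulAlgHom k N))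
  one : (convEvalOne k T A).comp Θ = (Algebra.ofId k A).comp (Bialgebra.counitAlgHom k N)

/-- The convolution-algebra homomorphism `N → Hom(T, A)` of a bimeasuring. -/
noncomputable def IsBimeasuring.algHom {N : Type*} [Ring N] [Bialgebra k N] {f : N ⊗[k] T →ₗ[k] A}
    (hf : IsBimeasuring f) : N →ₐ[k] WithConv (T →ₗ[k] A) :=
  AlgHom.ofLinearMap
    ((WithConv.linearEquiv k (T →ₗ[k] A)).symm.toLinearMap ∘ₗ TensorProduct.curry f)
    (by ext t; simpa using hf.right.map_one t)
    (fun n m => by ext t; exact hf.right.map_mul t n m)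

/-- The right-hand side of the measuring condition, as an external product evaluated on `t ⊗ s`. -/
theorem convExternalMul_map_apply {N : Type*} [Semiring N] [Algebra k N]
    (Θ : N →ₐ[k] WithConv (T →ₗ[k] A)) (z : N ⊗[k] N) (t s : T) (f : N ⊗[k] T →ₗ[k] A)
    (hf : ∀ n t, f (n ⊗ₜ t) = (Θ n).ofConv t) :
    (convExternalMul k T A (Algebra.TensorProduct.map Θ Θ z)).ofConv (t ⊗ₜ s) =
      LinearMap.mul' k A (TensorProduct.map ((TensorProduct.curry f).flip t)
        ((TensorProduct.curry f).flip s) z) := by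
  induction z with
  | zero => simp
  | tmul n m => simp [hf]
  | add x y hx hy => simp only [map_add, ofConv_add, LinearMap.add_apply, hx, hy]

theorem IsBimeasuring.isMeasuringHom {N : Type*} [Ring N] [Bialgebra k N] {f : N ⊗[k] T →ₗ[k] A}
    (hf : IsBimeasuring f) : hf.algHom.IsMeasuringHom where
  mul := by
    ext n t s
    refine (hf.left.map_mul n t s).trans ?_
    exact (convExternalMul_map_apply hf.algHom _ t s f fun _ _ => rfl).symm
  one := by
    ext n
    exact hf.left.map_one n

/-- The bilinear map of a homomorphism into a convolution algebra, on the tensor product. -/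
noncomputable def AlgHom.uncurryConv {N : Type*} [Semiring N] [Algebra k N]
    (Θ : N →ₐ[k] WithConv (T →ₗ[k] A)) : N ⊗[k] T →ₗ[k] A :=
  TensorProduct.lift ((WithConv.linearEquiv k (T →ₗ[k] A)).toLinearMap ∘ₗ Θ.toLinearMap)

theorem AlgHom.IsMeasuringHom.isBimeasuring {N : Type*} [Ring N] [Bialgebra k N]
    {Θ : N →ₐ[k] WithConv (T →ₗ[k] A)} (hΘ : Θ.IsMeasuringHom) :
    IsBimeasuring Θ.uncurryConv where
  left :=
    { map_mul := fun n t s => by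
        rw [← convExternalMul_map_apply Θ _ t s Θ.uncurryConv fun _ _ => rfl]
        exact congrArg (fun h : WithConv (T ⊗[k] T →ₗ[k] A) => h.ofConv (t ⊗ₜ s))
          (DFunLike.congr_fun hΘ.mul n)
      map_one := fun n => DFunLike.congr_fun hΘ.one n }
  right :=
    { map_mul := fun t n m => congrArg (fun h : WithConv (T →ₗ[k] A) => h.ofConv t) (map_mul Θ n m)
      map_one := fun t => congrArg (fun h : WithConv (T →ₗ[k] A) => h.ofConv t) (map_one Θ) }

/-- A factorization of a bimeasuring through a linear map, in terms of convolution algebras. -/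
theorem IsBimeasuring.eq_comp_rTensor_iff {N B : Type*} [Ring N] [Bialgebra k N] [Ring B]
    [Bialgebra k B] {f : N ⊗[k] T →ₗ[k] A} (hf : IsBimeasuring f) {θ : B ⊗[k] T →ₗ[k] A}
    (hθ : IsBimeasuring θ) (g : N →ₐc[k] B) :
    f = θ ∘ₗ LinearMap.rTensor T (g : N →ₗ[k] B) ↔
      hθ.algHom.comp (g : N →ₐ[k] B) = hf.algHom := by
  constructor
  · intro h
    ext n t
    exact (DFunLike.congr_fun h (n ⊗ₜ t)).symm
  · intro h
    ext n t
    exact congrArg (fun h : WithConv (T →ₗ[k] A) => h.ofConv t) (DFunLike.congr_fun h n).symm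

/-- The measuring conditions descend along surjective bialgebra homomorphisms. -/
theorem AlgHom.IsMeasuringHom.of_comp_surjective {N B : Type*} [Semiring N] [Bialgebra k N]
    [Semiring B] [Bialgebra k B] {Θ : B →ₐ[k] WithConv (T →ₗ[k] A)} (g : N →ₐc[k] B)
    (hg : Function.Surjective g) (h : (Θ.comp (g : N →ₐ[k] B)).IsMeasuringHom) :
    Θ.IsMeasuringHom where
  mul := (AlgHom.cancel_right hg).1 <| by
    rw [AlgHom.comp_assoc _ _ (g : N →ₐ[k] B), AlgHom.comp_assoc _ _ (g : N →ₐ[k] B),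
      AlgHom.comp_assoc _ _ (g : N →ₐ[k] B), ← BialgHom.map_comp_comulAlgHom,
      ← AlgHom.comp_assoc _ (Algebra.TensorProduct.map (g : N →ₐ[k] B) (g : N →ₐ[k] B)),
      ← Algebra.TensorProduct.map_comp]
    exact h.mul
  one := (AlgHom.cancel_right hg).1 <| by
    rw [AlgHom.comp_assoc _ _ (g : N →ₐ[k] B), AlgHom.comp_assoc _ _ (g : N →ₐ[k] B),
      BialgHom.counitAlgHom_comp]
    exact h.one

end Convolution

/-! ### The tower of iterated comultiplications -/

section Tower

variable (k : Type u) (T : Type v) (A : Type w) [Field k] [Ring T] [Bialgebra k T]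
  [Coalgebra.IsCocomm k T] [CommRing A] [Algebra k A]

/-- The commutative algebras `V₀ = k × Hom(T, A)` and `Vₙ₊₁ = Vₙ ⊗ Vₙ`. The factor `k` of `V₀` is the
target of the counit, which `Hom(T, A)` does not see when `A` is zero. -/
noncomputable def convTower : ℕ → CommAlgCat.{max u v w} k
  | 0 => .of k (k × WithConv (T →ₗ[k] A))
  | n + 1 => .of k (convTower n ⊗[k] convTower n)

/-- The augmentation of `Vₙ` corresponding to the counit. -/
noncomputable def convTowerCounit : ∀ n, convTower k T A n →ₐ[k] k
  | 0 => AlgHom.fst k k (WithConv (T →ₗ[k] A))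
  | n + 1 => (Algebra.TensorProduct.lmul' k (S := k)).comp
      (Algebra.TensorProduct.map (convTowerCounit n) (convTowerCounit n))

variable {k T A}

/-- The maps `Pₙ : N → Vₙ` attached to `Θ : N → Hom(T, A)`: `P₀` is the pair of the counit and `Θ`,
and `Pₙ₊₁ = (Pₙ ⊗ Pₙ) ∘ Δ`. -/
noncomputable def AlgHom.toConvTower {N : Type*} [Semiring N] [Bialgebra k N]
    (Θ : N →ₐ[k] WithConv (T →ₗ[k] A)) : ∀ n, N →ₐ[k] convTower k T A n
  | 0 => (Bialgebra.counitAlgHom k N).prod Θ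
  | n + 1 => (Algebra.TensorProduct.map (Θ.toConvTower n) (Θ.toConvTower n)).comp
      (Bialgebra.comulAlgHom k N)

variable {N : Type*} [Semiring N] [Bialgebra k N] (Θ : N →ₐ[k] WithConv (T →ₗ[k] A))

/-- The maps `Pₙ` are natural in bialgebra homomorphisms compatible with `Θ`. -/
theorem AlgHom.toConvTower_comp {M : Type*} [Semiring M] [Bialgebra k M] (g : M →ₐc[k] N) (n : ℕ) :
    (Θ.toConvTower n).comp (g : M →ₐ[k] N) = (Θ.comp (g : M →ₐ[k] N)).toConvTower n := by
  induction n with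
  | zero =>
    change ((Bialgebra.counitAlgHom k N).prod Θ).comp (g : M →ₐ[k] N) =
      (Bialgebra.counitAlgHom k M).prod (Θ.comp (g : M →ₐ[k] N))
    rw [← BialgHom.counitAlgHom_comp g]
    rfl
  | succ n ih =>
    change ((Algebra.TensorProduct.map (Θ.toConvTower n) (Θ.toConvTower n)).comp
      (Bialgebra.comulAlgHom k N)).comp (g : M →ₐ[k] N) =
      (Algebra.TensorProduct.map ((Θ.comp (g : M →ₐ[k] N)).toConvTower n)
        ((Θ.comp (g : M →ₐ[k] N)).toConvTower n)).comp (Bialgebra.comulAlgHom k M)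
    rw [AlgHom.comp_assoc, ← BialgHom.map_comp_comulAlgHom, ← AlgHom.comp_assoc,
      ← Algebra.TensorProduct.map_comp, ih]

theorem convTowerCounit_comp (n : ℕ) :
    (convTowerCounit k T A n).comp (Θ.toConvTower n) = Bialgebra.counitAlgHom k N := by
  induction n with
  | zero => rfl
  | succ n ih =>
    change ((Algebra.TensorProduct.lmul' k (S := k)).comp
      (Algebra.TensorProduct.map (convTowerCounit k T A n) (convTowerCounit k T A n))).comp
      ((Algebra.TensorProduct.map (Θ.toConvTower n) (Θ.toConvTower n)).comp
      (Bialgebra.comulAlgHom k N)) = _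
    rw [AlgHom.comp_assoc, ← AlgHom.comp_assoc _ (Algebra.TensorProduct.map (Θ.toConvTower n) _),
      ← Algebra.TensorProduct.map_comp, ih]
    ext a
    have h := congrArg (TensorProduct.map LinearMap.id (Coalgebra.counit (R := k) (A := N)))
      (Coalgebra.rTensor_counit_comul (R := k) a)
    rw [← LinearMap.comp_apply, LinearMap.rTensor, ← TensorProduct.map_comp] at h
    exact (congrArg (LinearMap.mul' k k) h).trans (by simp)

/-- The kernels of the maps `Pₙ` decrease, because `Pₙ` is recovered from `Pₙ₊₁` by the counit. -/
theorem AlgHom.toConvTower_eq_of_succ {a b : N} {n : ℕ}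
    (h : Θ.toConvTower (n + 1) a = Θ.toConvTower (n + 1) b) :
    Θ.toConvTower n a = Θ.toConvTower n b := by
  have key : ∀ z : N ⊗[k] N, Algebra.TensorProduct.lid k (convTower k T A n)
      (Algebra.TensorProduct.map (convTowerCounit k T A n) (AlgHom.id k _)
        (Algebra.TensorProduct.map (Θ.toConvTower n) (Θ.toConvTower n) z)) =
      Θ.toConvTower n (TensorProduct.lid k N
        ((Coalgebra.counit (R := k) (A := N)).rTensor N z)) := by
    intro z
    induction z with
    | zero => simp
    | tmul x y =>
      have := DFunLike.congr_fun (convTowerCounit_comp Θ n) x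
      simp only [AlgHom.comp_apply, Bialgebra.counitAlgHom_apply] at this
      simp [this]
    | add x y hx hy => simp only [map_add, hx, hy]
  have h2 := congrArg (fun z => Algebra.TensorProduct.lid k (convTower k T A n)
      (Algebra.TensorProduct.map (convTowerCounit k T A n) (AlgHom.id k _) z)) h
  have h3 := (key (Coalgebra.comul a)).symm.trans (h2.trans (key (Coalgebra.comul b)))
  simpa using h3

theorem AlgHom.toConvTower_eq_of_le {a b : N} {m n : ℕ} (hmn : m ≤ n)
    (h : Θ.toConvTower n a = Θ.toConvTower n b) : Θ.toConvTower m a = Θ.toConvTower m b := by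
  induction n, hmn using Nat.le_induction with
  | base => exact h
  | succ n _ ih => exact ih (Θ.toConvTower_eq_of_succ h)

/-- The map `P : N → ∏ₙ Vₙ` with components `Pₙ`. Its kernel is the largest biideal of `N` through
whose quotient `Θ` factors. -/
noncomputable def AlgHom.toConvTowerPi : N →ₐ[k] (∀ n, convTower k T A n) :=
  AlgHom.pi fun n => Θ.toConvTower n

theorem AlgHom.toConvTowerPi_eq_iff {a b : N} : Θ.toConvTowerPi a = Θ.toConvTowerPi b ↔
    ∀ n, Θ.toConvTower n a = Θ.toConvTower n b :=
  funext_iff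

theorem AlgHom.toConvTowerPi_comp_apply {M : Type*} [Semiring M] [Bialgebra k M] (g : M →ₐc[k] N)
    (a : M) : Θ.toConvTowerPi (g a) = (Θ.comp (g : M →ₐ[k] N)).toConvTowerPi a :=
  funext fun n => DFunLike.congr_fun (Θ.toConvTower_comp g n) a

/-- The kernel of `P` is a biideal: the quotient by it is a bialgebra to which a bimeasuring
descends. -/
theorem AlgHom.IsMeasuringHom.exists_quotient {Θ : N →ₐ[k] WithConv (T →ₗ[k] A)}
    (hΘ : Θ.IsMeasuringHom) {Q : Type y} [Ring Q] [Algebra k Q] (π : N →ₐ[k] Q)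
    (hπ : Function.Surjective π)
    (hker : ∀ a b, π a = π b ↔ Θ.toConvTowerPi a = Θ.toConvTowerPi b) :
    ∃ (B : Type y) (_ : Ring B) (_ : Bialgebra k B) (g : N →ₐc[k] B)
      (Θ' : B →ₐ[k] WithConv (T →ₗ[k] A)), Function.Surjective g ∧
      (∀ a b, g a = g b ↔ Θ.toConvTowerPi a = Θ.toConvTowerPi b) ∧
      Θ'.IsMeasuringHom ∧ Θ'.comp (g : N →ₐ[k] B) = Θ := by
  have hP : ∀ n a b, π a = π b → Θ.toConvTower n a = Θ.toConvTower n b := fun n a b h =>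
    Θ.toConvTowerPi_eq_iff.1 ((hker a b).1 h) n
  let p : ∀ n, Q →ₐ[k] convTower k T A n := fun n => AlgHom.descend π hπ (Θ.toConvTower n) (hP n)
  have hp : ∀ n, (p n).comp π = Θ.toConvTower n := fun n => AlgHom.descend_comp ..
  have hp' : ∀ n a, p n (π a) = Θ.toConvTower n a := fun n a => DFunLike.congr_fun (hp n) a
  have hcomul : ∀ a b, π a = π b →
      (Algebra.TensorProduct.map π π).comp (Bialgebra.comulAlgHom k N) a =
      (Algebra.TensorProduct.map π π).comp (Bialgebra.comulAlgHom k N) b := by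
    intro a b hab
    rw [← sub_eq_zero]
    refine TensorProduct.eq_zero_of_map_eq_zero (fun n => (p n).toLinearMap) ?_ ?_ _ fun n => ?_
    · intro m n hmn
      refine hπ.forall.2 fun c hc => ?_
      have h0 : Θ.toConvTower n c = Θ.toConvTower n 0 := by
        rw [map_zero, ← hp']; exact hc
      have h1 := Θ.toConvTower_eq_of_le hmn h0
      rw [map_zero, ← hp'] at h1
      exact h1
    · refine hπ.forall.2 fun c hc => ?_
      rw [← map_zero π, hker, Θ.toConvTowerPi_eq_iff]
      intro n
      rw [map_zero, ← hp']
      exact hc n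
    -- `(p n ⊗ p n) ∘ (π ⊗ π) ∘ Δ = Pₙ₊₁`, and `Pₙ₊₁` factors through `π`.
    · have h1 : ∀ c, TensorProduct.map (p n).toLinearMap (p n).toLinearMap
          ((Algebra.TensorProduct.map π π).comp (Bialgebra.comulAlgHom k N) c) =
          Θ.toConvTower (n + 1) c := fun c => by
        change ((Algebra.TensorProduct.map (p n) (p n)).comp (Algebra.TensorProduct.map π π))
          (Coalgebra.comul c) = _
        rw [← Algebra.TensorProduct.map_comp, hp]
        rfl
      rw [map_sub, sub_eq_zero]
      exact (h1 a).trans ((hP (n + 1) a b hab).trans (h1 b).symm)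
  have hcounit : ∀ a b, π a = π b → Bialgebra.counitAlgHom k N a = Bialgebra.counitAlgHom k N b :=
    fun a b h => congrArg Prod.fst (hP 0 a b h)
  have hΘ' : ∀ a b, π a = π b → Θ a = Θ b := fun a b h => congrArg Prod.snd (hP 0 a b h)
  let _ : Bialgebra k Q := Bialgebra.ofSurjective π hπ (AlgHom.descend π hπ _ hcomul)
    (AlgHom.descend π hπ _ hcounit) (AlgHom.descend_comp ..) (AlgHom.descend_comp ..)
  let g : N →ₐc[k] Q := BialgHom.ofAlgHom π (AlgHom.descend_comp π hπ _ hcounit)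
    (AlgHom.descend_comp π hπ _ hcomul).symm
  refine ⟨Q, inferInstance, inferInstance, g, AlgHom.descend π hπ Θ hΘ', hπ, hker, ?_,
    AlgHom.descend_comp ..⟩
  refine AlgHom.IsMeasuringHom.of_comp_surjective g hπ ?_
  rw [show (AlgHom.descend π hπ Θ hΘ').comp (g : N →ₐ[k] Q) = Θ from AlgHom.descend_comp ..]
  exact hΘ

end Tower

/-! ### Free products of bialgebras -/

section FreeProduct

open LinearAlgebra

variable {k I : Type*} [Field k] [DecidableEq I] {N : I → Type*}

theorem LinearAlgebra.FreeProduct.algHom_ext [∀ i, Semiring (N i)] [∀ i, Algebra k (N i)]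
    {B : Type*} [Semiring B] [Algebra k B] {f g : FreeProduct k N →ₐ[k] B}
    (h : ∀ i, f.comp (FreeProduct.ι k N i) = g.comp (FreeProduct.ι k N i)) : f = g :=
  (FreeProduct.lift_unique k N (fun {i} => g.comp (FreeProduct.ι k N i)) f h).trans
    (FreeProduct.lift_unique k N (fun {i} => g.comp (FreeProduct.ι k N i)) g fun _ => rfl).symm

variable [∀ i, Semiring (N i)] [∀ i, Bialgebra k (N i)]

variable (k N) in
/-- The comultiplication of the free product, given by those of the factors. -/
noncomputable def LinearAlgebra.FreeProduct.comulHom :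
    FreeProduct k N →ₐ[k] FreeProduct k N ⊗[k] FreeProduct k N :=
  FreeProduct.lift k N fun {i} =>
    (Algebra.TensorProduct.map (FreeProduct.ι k N i) (FreeProduct.ι k N i)).comp
      (Bialgebra.comulAlgHom k (N i))

variable (k N) in
/-- The counit of the free product, given by those of the factors. -/
noncomputable def LinearAlgebra.FreeProduct.counitHom : FreeProduct k N →ₐ[k] k :=
  FreeProduct.lift k N fun {i} => Bialgebra.counitAlgHom k (N i)

theorem LinearAlgebra.FreeProduct.comulHom_comp_ι (i : I) :
    (comulHom k N).comp (FreeProduct.ι k N i) =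
      (Algebra.TensorProduct.map (FreeProduct.ι k N i) (FreeProduct.ι k N i)).comp
        (Bialgebra.comulAlgHom k (N i)) :=
  FreeProduct.lift_comp_ι k N fun {i} =>
    (Algebra.TensorProduct.map (FreeProduct.ι k N i) (FreeProduct.ι k N i)).comp
      (Bialgebra.comulAlgHom k (N i))

theorem LinearAlgebra.FreeProduct.counitHom_comp_ι (i : I) :
    (counitHom k N).comp (FreeProduct.ι k N i) = Bialgebra.counitAlgHom k (N i) :=
  FreeProduct.lift_comp_ι k N fun {i} => Bialgebra.counitAlgHom k (N i)

open Coalgebra in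
/-- The free product of a family of bialgebras is a bialgebra, its structure maps extending those of
the factors. -/
noncomputable instance LinearAlgebra.FreeProduct.instBialgebra : Bialgebra k (FreeProduct k N) := by
  have hΔ : ∀ i, (comulHom k N).toLinearMap ∘ₗ (FreeProduct.ι k N i).toLinearMap =
      TensorProduct.map (FreeProduct.ι k N i).toLinearMap (FreeProduct.ι k N i).toLinearMap ∘ₗ
        comul := fun i => congr(($(comulHom_comp_ι i)).toLinearMap)
  have hε : ∀ i, (counitHom k N).toLinearMap ∘ₗ (FreeProduct.ι k N i).toLinearMap = counit :=
    fun i => congr(($(counitHom_comp_ι i)).toLinearMap)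
  refine .ofAlgHom (comulHom k N) (counitHom k N) ?_ ?_ ?_ <;>
    refine FreeProduct.algHom_ext fun i => AlgHom.toLinearMap_injective ?_ <;>
    simp only [coassoc_simps, AlgHom.comp_toLinearMap, Algebra.TensorProduct.toLinearMap_map,
      hΔ, hε]
  · simp [coassoc_simps]
  · rw [CoassocSimps.map_counit_comp_comul_left]; rfl
  · rw [CoassocSimps.map_counit_comp_comul_right]; rfl

variable (k N) in
/-- The canonical map of a factor to the free product, as a bialgebra homomorphism. -/
noncomputable def LinearAlgebra.FreeProduct.ιBialgHom (i : I) : N i →ₐc[k] FreeProduct k N :=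
  BialgHom.ofAlgHom (FreeProduct.ι k N i) (counitHom_comp_ι i) (comulHom_comp_ι i).symm

/-- The measuring conditions on a free product need only be checked on the factors. -/
theorem LinearAlgebra.FreeProduct.isMeasuringHom {T A : Type*} [Ring T] [Bialgebra k T] [CommRing A]
    [Algebra k A] {Θ : FreeProduct k N →ₐ[k] WithConv (T →ₗ[k] A)}
    (h : ∀ i, (Θ.comp (FreeProduct.ι k N i)).IsMeasuringHom) : Θ.IsMeasuringHom where
  mul := FreeProduct.algHom_ext fun i => by
    have h1 := comulHom_comp_ι (k := k) (N := N) i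
    change _ = ((convExternalMul k T A).comp ((Algebra.TensorProduct.map Θ Θ).comp
      (comulHom k N))).comp _
    rw [AlgHom.comp_assoc, AlgHom.comp_assoc, AlgHom.comp_assoc, h1,
      ← AlgHom.comp_assoc _ (Algebra.TensorProduct.map (FreeProduct.ι k N i) _),
      ← Algebra.TensorProduct.map_comp]
    exact (h i).mul
  one := FreeProduct.algHom_ext fun i => by
    change _ = ((Algebra.ofId k A).comp (counitHom k N)).comp _
    rw [AlgHom.comp_assoc, AlgHom.comp_assoc, counitHom_comp_ι]
    exact (h i).one

end FreeProduct

/-! ### Existence and commutativity -/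

section Universal

open LinearAlgebra

variable {k : Type u} {T : Type v} {A : Type w} [Field k] [Ring T] [Bialgebra k T]
  [Coalgebra.IsCocomm k T] [CommRing A] [Algebra k A]

/-- The map `P` of a universal bimeasuring is injective: the quotient map `B → B / ker P` has a
retraction, induced by the bimeasuring of `B / ker P`. -/
theorem IsUniversalBimeasuring.toConvTowerPi_injective {B : Type y} [Ring B] [Bialgebra k B]
    {θ : B ⊗[k] T →ₗ[k] A} (hθ : IsUniversalBimeasuring θ) :
    Function.Injective hθ.isBimeasuring.algHom.toConvTowerPi := by
  set Θ := hθ.isBimeasuring.algHom with hΘ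
  let J := RingHom.ker Θ.toConvTowerPi
  obtain ⟨C, _, _, g, Θ', -, hg, hm, hc⟩ := hθ.isBimeasuring.isMeasuringHom.exists_quotient
    (Ideal.Quotient.mkₐ k J) Ideal.Quotient.mk_surjective fun a b => by
      rw [Ideal.Quotient.mkₐ_eq_mk, Ideal.Quotient.eq, RingHom.mem_ker, map_sub, sub_eq_zero]
  obtain ⟨s, hs, -⟩ := hθ.existsUnique_hom C Θ'.uncurryConv hm.isBimeasuring
  have hid : s.comp g = BialgHom.id k B := by
    refine (hθ.existsUnique_hom B θ hθ.isBimeasuring).unique ?_ ?_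
    · rw [hθ.isBimeasuring.eq_comp_rTensor_iff hθ.isBimeasuring, BialgHom.comp_toAlgHom,
        ← AlgHom.comp_assoc, (hm.isBimeasuring.eq_comp_rTensor_iff hθ.isBimeasuring s).1 hs]
      exact hc
    · rw [hθ.isBimeasuring.eq_comp_rTensor_iff hθ.isBimeasuring]
      rfl
  intro a b hab
  calc a = s.comp g a := by rw [hid]; rfl
    _ = s.comp g b := congrArg s ((hg a b).2 hab)
    _ = b := by rw [hid]; rfl

/-- The image of `P` on the free product of all bialgebras with a bimeasuring is a universal
bimeasuring bialgebra. -/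
theorem exists_isUniversalBimeasuring :
    ∃ (B : Type (max u v w)) (_ : Ring B) (_ : Bialgebra k B) (θ : B ⊗[k] T →ₗ[k] A),
      IsUniversalBimeasuring θ := by
  classical
  -- This index type lies one universe higher; the image of `P` below returns to `max u v w`.
  let I := Σ (N : Type (max u v w)) (_ : Ring N) (_ : Bialgebra k N),
    {f : N ⊗[k] T →ₗ[k] A // IsBimeasuring f}
  let N : I → Type (max u v w) := fun i => i.1
  let _ : ∀ i, Ring (N i) := fun i => i.2.1
  let _ : ∀ i, Bialgebra k (N i) := fun i => i.2.2.1
  let Φ : ∀ i, N i →ₐ[k] WithConv (T →ₗ[k] A) := fun i => i.2.2.2.2.algHom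
  let Θ : FreeProduct k N →ₐ[k] WithConv (T →ₗ[k] A) := FreeProduct.lift k N fun {i} => Φ i
  have hΘι : ∀ i, Θ.comp (FreeProduct.ι k N i) = Φ i := fun i =>
    FreeProduct.lift_comp_ι k N fun {i} => Φ i
  have hΘ : Θ.IsMeasuringHom := FreeProduct.isMeasuringHom fun i => by
    rw [hΘι]; exact i.2.2.2.2.isMeasuringHom
  obtain ⟨B, _, _, q, Θ', hqs, hq, hm, hc⟩ := hΘ.exists_quotient (Q := Θ.toConvTowerPi.range)
    Θ.toConvTowerPi.rangeRestrict Θ.toConvTowerPi.rangeRestrict_surjective fun a b => Subtype.ext_iff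
  -- By naturality, `P` of the image `B` restricts along `q` to `P` of the free product.
  have hinj : Function.Injective Θ'.toConvTowerPi := hqs.forall₂.2 fun a b h => by
    rw [Θ'.toConvTowerPi_comp_apply, Θ'.toConvTowerPi_comp_apply, hc] at h
    exact (hq a b).2 h
  refine ⟨B, inferInstance, inferInstance, Θ'.uncurryConv, hm.isBimeasuring,
    fun M _ _ f hf => ?_⟩
  let i : I := ⟨M, inferInstance, inferInstance, f, hf⟩
  have hj : Θ'.comp (q.comp (FreeProduct.ιBialgHom k N i) : M →ₐ[k] B) = hf.algHom := by
    change (Θ'.comp (q : FreeProduct k N →ₐ[k] B)).comp (FreeProduct.ι k N i) = hf.algHom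
    rw [hc, hΘι]
  refine ⟨q.comp (FreeProduct.ιBialgHom k N i),
    (hf.eq_comp_rTensor_iff hm.isBimeasuring _).2 hj, fun g hg => BialgHom.ext fun a => hinj ?_⟩
  have hg' : Θ'.comp (g : M →ₐ[k] B) = hf.algHom :=
    (hf.eq_comp_rTensor_iff hm.isBimeasuring g).1 hg
  rw [Θ'.toConvTowerPi_comp_apply, Θ'.toConvTowerPi_comp_apply, hg', hj]

end Universal

theorem mainTheorem11 (k : Type u) [Field k]
    (T : Type v) [Ring T] [Bialgebra k T] [Coalgebra.IsCocomm k T]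
    (A : Type w) [CommRing A] [Algebra k A] :
    (∃ (B : Type (max u v w)) (_ : Ring B) (_ : Bialgebra k B) (θ : B ⊗[k] T →ₗ[k] A),
      IsUniversalBimeasuring θ) ∧
    ∀ (B : Type y) [Ring B] [Bialgebra k B] (θ : B ⊗[k] T →ₗ[k] A),
      IsUniversalBimeasuring θ → ∀ a b : B, a * b = b * a := by
  refine ⟨exists_isUniversalBimeasuring, fun B _ _ θ hθ a b => hθ.toConvTowerPi_injective ?_⟩
  rw [map_mul, map_mul, mul_comm]
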